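/- Let $d\ge 1$, and let $p_1,p_2$ denote the projections of $\mathbb{R}^d\times\mathbb{R}$ onto $\mathbb{R}^d$ and $\mathbb{R}$. Let $\Gamma\subset\mathbb{R}^d\times\mathbb{R}$ be a (full-rank) lattice such that $p_1|_\Gamma$ and $p_2|_\Gamma$ are injective and $p_1(\Gamma)$, $p_2(\Gamma)$ are dense in $\mathbb{R}^d$, $\mathbb{R}$. Let $\det\Gamma$ be its covolume and $\Gamma^*=\{y : \langle x,y\rangle\in\mathbb{Z}\ \text{for all } x\in\Gamma\}$ its dual lattice. Let $a<b$, let $I=[a,b)$ or $I=(a,b]$, write $|I|=b-a$, assume $|I|\in p_2(\Gamma)$, and put $$\Lambda=\Lambda(\Gamma,I)=\{p_1(\gamma) : \gamma\in\Gamma,\ p_2(\gamma)\in I\}.$$ For a set $\Lambda\subset\mathbb{R}^d$ let $$\mathscr{D}^-(\Lambda)=\liminf_{R\to\infty}\inf_{x\in\mathbb{R}^d}\frac{\#(\Lambda\cap(x+B_R))}{|B_R|},\qquad \mathscr{D}^+(\Lambda)=\limsup_{R\to\infty}\sup_{x\in\mathbb{R}^d}\frac{\#(\Lambda\cap(x+B_R))}{|B_R|},$$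 where $B_R$ is the ball of radius $R$ centered at the origin; if these two are equal, the common value is the uniform density $\mathscr{D}(\Lambda)$. A bounded set $S\subset\mathbb{R}^d$ is called Riemann measurable if its boundary has Lebesgue measure zero. Given a group $G\subset\mathbb{R}^d$ of vectors, two Riemann measurable sets $S,S'$ are called equidecomposable using only translations by vectors in $G$ if $S$ can be partitioned into finitely many Riemann measurable subsets which, after translation by suitable vectors of $G$, form, up to measure zero, a partition of $S'$. Then $\Lambda$ has a uniform density, equal to $\mathscr{D}(\Lambda)=|I|/\det\Gamma$. Moreover, if $K$ is a compact set and $U$ an open set in $\mathbb{R}^d$ with $K\subset U$ and $\operatorname{mes}K<\mathscr{D}(\Lambda)<\operatorname{mes}U$, then there is a Riemann measurable set $S$ with $K\subset S\subset U$ such that 1. $\operatorname{mes}S=\mathscr{D}(\Lambda)$; 2. $S$ is equidecomposable to a parallelepiped spanned by $d$ linearly independent vectors in $p_1(\Gamma^*)$, using only translations by vectors in $p_1(\Gamma^*)$. -/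

import Mathlib

open Set Filter MeasureTheory
open scoped ENNReal Pointwise RealInnerProductSpace

namespace Quasicrystal

/-- The lattice `Γ ⊆ ℝᵈ × ℝ` is in general position: both coordinate projections are injective
on `Γ` and have dense image. -/
structure GeneralPosition {d : ℕ} (Γ : Submodule ℤ (EuclideanSpace ℝ (Fin d) × ℝ)) : Prop where
  injOn_fst : Set.InjOn Prod.fst (Γ : Set (EuclideanSpace ℝ (Fin d) × ℝ))
  injOn_snd : Set.InjOn Prod.snd (Γ : Set (EuclideanSpace ℝ (Fin d) × ℝ))
  dense_fst : Dense (Prod.fst '' (Γ : Set (EuclideanSpace ℝ (Fin d) × ℝ)))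
  dense_snd : Dense (Prod.snd '' (Γ : Set (EuclideanSpace ℝ (Fin d) × ℝ)))

/-- The dual lattice `Γ*`: all vectors whose Euclidean inner product in `ℝᵈ × ℝ = ℝᵈ⁺¹` with
every vector of `Γ` is an integer. -/
def dualLattice {d : ℕ} (Γ : Submodule ℤ (EuclideanSpace ℝ (Fin d) × ℝ)) :
    AddSubgroup (EuclideanSpace ℝ (Fin d) × ℝ) where
  carrier := {y | ∀ x ∈ Γ, ∃ n : ℤ, ⟪x.1, y.1⟫ + x.2 * y.2 = (n : ℝ)}
  zero_mem' := fun x _ => ⟨0, by simp⟩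
  add_mem' := by
    intro y z hy hz x hx
    obtain ⟨m, hm⟩ := hy x hx
    obtain ⟨n, hn⟩ := hz x hx
    refine ⟨m + n, ?_⟩
    rw [Prod.fst_add, Prod.snd_add, inner_add_right]
    push_cast
    linarith
  neg_mem' := by
    intro y hy x hx
    obtain ⟨m, hm⟩ := hy x hx
    refine ⟨-m, ?_⟩
    rw [Prod.fst_neg, Prod.snd_neg, inner_neg_right]
    push_cast
    linarith

/-- The group `p₁(Γ*) ⊆ ℝᵈ`. -/
def dualProj {d : ℕ} (Γ : Submodule ℤ (EuclideanSpace ℝ (Fin d) × ℝ)) :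
    AddSubgroup (EuclideanSpace ℝ (Fin d)) :=
  (dualLattice Γ).map (AddMonoidHom.fst (EuclideanSpace ℝ (Fin d)) ℝ)

/-- The cut-and-project set `Λ(Γ, I) = {p₁(γ) : γ ∈ Γ, p₂(γ) ∈ I}`. -/
def modelSet {d : ℕ} (Γ : Submodule ℤ (EuclideanSpace ℝ (Fin d) × ℝ)) (I : Set ℝ) :
    Set (EuclideanSpace ℝ (Fin d)) :=
  {x | ∃ γ ∈ Γ, γ.2 ∈ I ∧ γ.1 = x}

/-- The Beurling lower uniform density. -/
noncomputable def lowerDensity {d : ℕ} (Λ : Set (EuclideanSpace ℝ (Fin d))) : ℝ≥0∞ :=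
  liminf (fun R : ℝ => ⨅ x : EuclideanSpace ℝ (Fin d),
    ((Λ ∩ Metric.ball x R).encard : ℝ≥0∞) /
      volume (Metric.ball (0 : EuclideanSpace ℝ (Fin d)) R)) atTop

/-- The Beurling upper uniform density. -/
noncomputable def upperDensity {d : ℕ} (Λ : Set (EuclideanSpace ℝ (Fin d))) : ℝ≥0∞ :=
  limsup (fun R : ℝ => ⨆ x : EuclideanSpace ℝ (Fin d),
    ((Λ ∩ Metric.ball x R).encard : ℝ≥0∞) /
      volume (Metric.ball (0 : EuclideanSpace ℝ (Fin d)) R)) atTop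

/-- `Λ` has uniform density `D`: the lower and upper densities are both equal to `D`. -/
def HasUniformDensity {d : ℕ} (Λ : Set (EuclideanSpace ℝ (Fin d))) (D : ℝ≥0∞) : Prop :=
  lowerDensity Λ = D ∧ upperDensity Λ = D

/-- A bounded set whose boundary has Lebesgue measure zero. -/
def RiemannMeasurable {d : ℕ} (S : Set (EuclideanSpace ℝ (Fin d))) : Prop :=
  Bornology.IsBounded S ∧ volume (frontier S) = 0

/-- `S` can be partitioned into finitely many Riemann measurable subsets, whose translates by
suitable vectors of the group `G` form, up to measure zero, a partition of `S'`. -/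
def EquidecomposableByTranslations {d : ℕ} (G : AddSubgroup (EuclideanSpace ℝ (Fin d)))
    (S S' : Set (EuclideanSpace ℝ (Fin d))) : Prop :=
  ∃ (N : ℕ) (A : Fin N → Set (EuclideanSpace ℝ (Fin d))) (v : Fin N → EuclideanSpace ℝ (Fin d)),
    (∀ i, RiemannMeasurable (A i)) ∧
    Pairwise (fun i j => Disjoint (A i) (A j)) ∧
    (⋃ i, A i) = S ∧
    (∀ i, v i ∈ G) ∧
    Pairwise (fun i j => AEDisjoint volume (v i +ᵥ A i) (v j +ᵥ A j)) ∧
    (⋃ i, (v i +ᵥ A i)) =ᵐ[volume] S'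

end Quasicrystal

namespace Quasicrystal

/-! Density: let `γ₀ ∈ Γ` have height `b - a`. Both the strip `p₂ ∈ I` and the union of the lattice
cells based at points of `Γ` with height in `I` are fundamental domains for `ℤγ₀`. An oblique
cylinder parallel to `γ₀` is `ℤγ₀`-invariant, so it meets both in the same volume: `|I|` times that
of the ball on one side, and on the other, up to a bounded change of radius, `det Γ` times the
number of points of `Λ` in the ball (`exists_encard_modelSet_bounds`).

The set `S`: write `γ₀ = n e` with `e` in a basis of `Γ`. By Cramer's rule the first projections of
the other `d` dual basis vectors, one of them multiplied by `n`, span a parallelepiped `P` of volume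
`|I| / det Γ` (`exists_dual_parallelepiped`). The group `p₁(Γ*)` is dense, since otherwise biduality
would give a nonzero `(u, 0) ∈ Γ` (`dense_dualProj`). With dense translations, a Riemann measurable
set can be cut up and packed into any open set of larger measure
(`embedsByTranslations_of_volume_lt`). Pack a neighbourhood `A` of `K` into `P`, then pack what is
left of `P` into `U \ closure A`; together `A` and these last pieces form `S`
(`exists_equidecomposable_between`). -/

variable {d : ℕ}

/-! ### Grids of half-open cubes -/

/-- The half-open cube of side `ε` with lowest corner `p`. -/
def cube (ε : ℝ) (p : EuclideanSpace ℝ (Fin d)) : Set (EuclideanSpace ℝ (Fin d)) :=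
  {x | ∀ i, p i ≤ x i ∧ x i < p i + ε}

/-- The point of the grid `ε ℤᵈ` with index `k`. -/
noncomputable def gridPoint (ε : ℝ) (k : Fin d → ℤ) : EuclideanSpace ℝ (Fin d) :=
  WithLp.toLp 2 fun i => ε * k i

lemma cube_eq_preimage (ε : ℝ) (p : EuclideanSpace ℝ (Fin d)) :
    cube ε p = WithLp.ofLp ⁻¹' (Set.univ.pi fun i => Ico (p i) (p i + ε)) := by
  ext x
  simp [cube]

lemma measurableSet_cube (ε : ℝ) (p : EuclideanSpace ℝ (Fin d)) : MeasurableSet (cube ε p) := by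
  rw [cube_eq_preimage]
  exact (PiLp.volume_preserving_ofLp (Fin d)).measurable
    (MeasurableSet.univ_pi fun i => measurableSet_Ico)

lemma volume_cube (ε : ℝ) (p : EuclideanSpace ℝ (Fin d)) :
    volume (cube ε p) = ENNReal.ofReal ε ^ d := by
  rw [cube_eq_preimage, (PiLp.volume_preserving_ofLp (Fin d)).measure_preimage
    (MeasurableSet.univ_pi fun i => measurableSet_Ico).nullMeasurableSet, Real.volume_pi_Ico]
  simp

lemma convex_cube (ε : ℝ) (p : EuclideanSpace ℝ (Fin d)) : Convex ℝ (cube ε p) := by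
  rw [cube_eq_preimage]
  exact (convex_pi fun i _ => convex_Ico _ _).linear_preimage
    (WithLp.linearEquiv 2 ℝ (Fin d → ℝ)).toLinearMap

lemma dist_le_of_mem_cube {ε : ℝ} (hε : 0 ≤ ε) {p x y : EuclideanSpace ℝ (Fin d)}
    (hx : x ∈ cube ε p) (hy : y ∈ cube ε p) : dist x y ≤ √d * ε := by
  rw [EuclideanSpace.dist_eq]
  have : ∑ i, dist (x i) (y i) ^ 2 ≤ d * ε ^ 2 := by
    calc ∑ i, dist (x i) (y i) ^ 2 ≤ ∑ _i : Fin d, ε ^ 2 := by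
          refine Finset.sum_le_sum fun i _ => ?_
          have h1 := hx i
          have h2 := hy i
          gcongr
          rw [Real.dist_eq, abs_le]
          constructor <;> linarith
      _ = d * ε ^ 2 := by simp
  calc √(∑ i, dist (x i) (y i) ^ 2) ≤ √(d * ε ^ 2) := Real.sqrt_le_sqrt this
    _ = √d * ε := by rw [Real.sqrt_mul (by positivity), Real.sqrt_sq hε]

lemma riemannMeasurable_inter {A B : Set (EuclideanSpace ℝ (Fin d))} (hA : RiemannMeasurable A)
    (hB : volume (frontier B) = 0) : RiemannMeasurable (A ∩ B) :=
  ⟨hA.1.subset inter_subset_left, null_frontier_inter hA.2 hB⟩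

lemma mem_cube_floor {ε : ℝ} (hε : 0 < ε) (x : EuclideanSpace ℝ (Fin d)) :
    x ∈ cube ε (gridPoint ε fun i => ⌊x i / ε⌋) := by
  intro i
  have h1 := Int.floor_le (x i / ε)
  have h2 := Int.lt_floor_add_one (x i / ε)
  rw [le_div_iff₀ hε] at h1
  rw [div_lt_iff₀ hε] at h2
  simp only [gridPoint]
  constructor <;> linarith

lemma pairwise_disjoint_cube {ε : ℝ} (hε : 0 < ε) :
    Pairwise (Function.onFun Disjoint fun k : Fin d → ℤ => cube ε (gridPoint ε k)) := by
  have key : ∀ (k : Fin d → ℤ) (x : EuclideanSpace ℝ (Fin d)), x ∈ cube ε (gridPoint ε k) →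
      k = fun i => ⌊x i / ε⌋ := by
    intro k x hx
    funext i
    have h := hx i
    simp only [gridPoint] at h
    symm
    rw [Int.floor_eq_iff, le_div_iff₀ hε, div_lt_iff₀ hε]
    constructor <;> linarith
  intro k l hkl
  refine Set.disjoint_left.2 fun x hx hy => hkl ?_
  rw [key k x hx, key l x hy]

lemma encard_mul_le_volume {ε : ℝ} (hε : 0 < ε) {s : Set (Fin d → ℤ)}
    {W : Set (EuclideanSpace ℝ (Fin d))} (h : ∀ k ∈ s, cube ε (gridPoint ε k) ⊆ W) :
    (s.encard : ℝ≥0∞) * ENNReal.ofReal ε ^ d ≤ volume W := by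
  calc (s.encard : ℝ≥0∞) * ENNReal.ofReal ε ^ d
      = volume (⋃ k ∈ s, cube ε (gridPoint ε k)) := by
        rw [measure_biUnion s.to_countable ((pairwise_disjoint_cube hε).set_pairwise s)
          fun k _ => measurableSet_cube _ _]
        simp only [volume_cube, ENNReal.tsum_set_const]
    _ ≤ volume W := measure_mono (iUnion₂_subset h)

lemma volume_le_encard_mul {ε : ℝ} {s : Set (Fin d → ℤ)}
    {W : Set (EuclideanSpace ℝ (Fin d))} (h : W ⊆ ⋃ k ∈ s, cube ε (gridPoint ε k)) :
    volume W ≤ (s.encard : ℝ≥0∞) * ENNReal.ofReal ε ^ d := by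
  calc volume W ≤ volume (⋃ k ∈ s, cube ε (gridPoint ε k)) := measure_mono h
    _ ≤ ∑' k : s, volume (cube ε (gridPoint ε (k : Fin d → ℤ))) :=
        measure_biUnion_le _ s.to_countable _
    _ = _ := by simp only [volume_cube, ENNReal.tsum_set_const]

/-- The grid cubes of side `ε` meeting `A`. -/
def meeting (ε : ℝ) (A : Set (EuclideanSpace ℝ (Fin d))) : Set (Fin d → ℤ) :=
  {k | (A ∩ cube ε (gridPoint ε k)).Nonempty}

lemma subset_biUnion_meeting {ε : ℝ} (hε : 0 < ε) (A : Set (EuclideanSpace ℝ (Fin d))) :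
    A ⊆ ⋃ k ∈ meeting ε A, cube ε (gridPoint ε k) := fun x hx =>
  mem_iUnion₂.2 ⟨_, ⟨x, hx, mem_cube_floor hε x⟩, mem_cube_floor hε x⟩

lemma cube_subset_cthickening {ε δ : ℝ} (hε : 0 ≤ ε) (hδ : √d * ε ≤ δ)
    {A : Set (EuclideanSpace ℝ (Fin d))} {k : Fin d → ℤ} (hk : k ∈ meeting ε A) :
    cube ε (gridPoint ε k) ⊆ Metric.cthickening δ A := by
  obtain ⟨y, hyA, hy⟩ := hk
  exact fun x hx => Metric.mem_cthickening_of_dist_le x y δ A hyA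
    ((dist_le_of_mem_cube hε hx hy).trans hδ)

/-- A dense set of translations contains one which moves a cube into a given larger cube. -/
lemma exists_vadd_cube_subset {G : Set (EuclideanSpace ℝ (Fin d))} (hG : Dense G) {ε ε' : ℝ}
    (h : ε < ε') (p q : EuclideanSpace ℝ (Fin d)) : ∃ g ∈ G, g +ᵥ cube ε p ⊆ cube ε' q := by
  have hpos : 0 < (ε' - ε) / 2 := by linarith
  -- The target shift centres the small cube in the large one, which leaves a margin of `(ε' - ε) /
  -- 2` on every side.
  obtain ⟨g, hg, hdist⟩ := hG.exists_dist_lt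
    (q - p + WithLp.toLp 2 fun _ => (ε' - ε) / 2) hpos
  refine ⟨g, hg, ?_⟩
  rintro _ ⟨x, hx, rfl⟩ i
  have hi := hx i
  have h1 : |q i - p i + (ε' - ε) / 2 - g i| < (ε' - ε) / 2 := by
    refine lt_of_le_of_lt ?_ hdist
    rw [dist_eq_norm]
    exact PiLp.norm_apply_le (q - p + (WithLp.toLp 2 fun _ => (ε' - ε) / 2) - g) i
  rw [abs_lt] at h1
  simp only [vadd_eq_add, PiLp.add_apply]
  constructor <;> linarith

/-! ### Packing a set into an open set of larger measure -/

/-- `A` can be cut into finitely many Riemann measurable pieces which are moved by vectors of `G`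
to pairwise disjoint subsets of `V`. -/
def EmbedsByTranslations (G : AddSubgroup (EuclideanSpace ℝ (Fin d)))
    (A V : Set (EuclideanSpace ℝ (Fin d))) : Prop :=
  ∃ (N : ℕ) (B : Fin N → Set (EuclideanSpace ℝ (Fin d))) (v : Fin N → EuclideanSpace ℝ (Fin d)),
    (∀ i, RiemannMeasurable (B i)) ∧ Pairwise (Function.onFun Disjoint B) ∧ (⋃ i, B i) = A ∧
    (∀ i, v i ∈ G) ∧ Pairwise (Function.onFun Disjoint fun i => v i +ᵥ B i) ∧
    ∀ i, v i +ᵥ B i ⊆ V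

/-- For a fine grid, the cubes of side `ε` meeting `A` are no more numerous than the cubes of side
`t * ε` meeting a compact `C ⊆ V`, with `t` slightly above 1. Match them injectively: each small
cube has room to be moved into its large cube by a vector of the dense group `G`, and the images are
disjoint because the large cubes are. -/
theorem embedsByTranslations_of_volume_lt {G : AddSubgroup (EuclideanSpace ℝ (Fin d))}
    (hG : Dense (G : Set (EuclideanSpace ℝ (Fin d)))) {A V : Set (EuclideanSpace ℝ (Fin d))}
    (hA : RiemannMeasurable A) (hV : IsOpen V) (hAV : volume A < volume V) :
    EmbedsByTranslations G A V := by
  obtain ⟨C, hCV, hC, hAC⟩ := hV.exists_lt_isCompact hAV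
  obtain ⟨m, hAm, hmC⟩ := exists_between hAC
  have hAc : IsCompact (closure A) := hA.1.isCompact_closure
  -- The measure of the thickenings of `A` tends to that of its closure, hence the need for a null
  -- boundary.
  rw [← measure_closure_of_null_frontier hA.2] at hAm
  obtain ⟨δ₂, hδ₂, hCδ⟩ := hC.exists_cthickening_subset_open hV hCV
  obtain ⟨δ₁, hAδ, hδ₁⟩ : ∃ δ₁, volume (Metric.cthickening δ₁ (closure A)) < m ∧ 0 < δ₁ :=
    ((((tendsto_measure_cthickening_of_isCompact (μ := volume) hAc).eventually_lt_const
      hAm).filter_mono nhdsWithin_le_nhds).and self_mem_nhdsWithin).exists (f := nhdsWithin 0 (Ioi 0))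
  obtain ⟨t, htC, ht⟩ : ∃ t : ℝ, ENNReal.ofReal t ^ d * m < volume C ∧ 1 < t := by
    have hcont : Tendsto (fun t : ℝ => ENNReal.ofReal t ^ d * m) (nhds 1)
        (nhds (ENNReal.ofReal 1 ^ d * m)) :=
      ENNReal.Tendsto.mul_const
        (((ENNReal.continuous_pow d).comp ENNReal.continuous_ofReal).tendsto 1)
        (Or.inr (ne_top_of_lt hmC))
    simp only [ENNReal.ofReal_one, one_pow, one_mul] at hcont
    exact (((hcont.eventually_lt_const hmC).filter_mono nhdsWithin_le_nhds).and
      self_mem_nhdsWithin).exists (f := nhdsWithin 1 (Ioi 1))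
  have ht0 : 0 < t := by linarith
  -- The diameters are small enough that small cubes meeting `A` have total measure below `m`, and
  -- large cubes meeting `C` stay in `V`.
  obtain ⟨ε, hε, hε₁, hε₂⟩ : ∃ ε : ℝ, 0 < ε ∧ √d * ε ≤ δ₁ ∧ √d * (t * ε) ≤ δ₂ := by
    have hcont : Continuous fun ε : ℝ => √d * ε := by fun_prop
    have hcont' : Continuous fun ε : ℝ => √d * (t * ε) := by fun_prop
    have h1 := hcont.tendsto 0
    have h2 := hcont'.tendsto 0
    simp only [mul_zero] at h1 h2
    obtain ⟨ε, ⟨h3, h4⟩, h5⟩ := ((((h1.eventually_lt_const hδ₁).and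
      (h2.eventually_lt_const hδ₂)).filter_mono nhdsWithin_le_nhds).and
      self_mem_nhdsWithin).exists (f := nhdsWithin 0 (Ioi 0))
    exact ⟨ε, h5, h3.le, h4.le⟩
  have hεd : ENNReal.ofReal ε ^ d ≠ 0 := pow_ne_zero _ (by simpa using hε)
  have hεd' : ENNReal.ofReal ε ^ d ≠ ∞ := ENNReal.pow_ne_top ENNReal.ofReal_ne_top
  have hcountA : ((meeting ε A).encard : ℝ≥0∞) * ENNReal.ofReal ε ^ d < m :=
    (encard_mul_le_volume hε fun k hk =>
      (cube_subset_cthickening hε.le hε₁ hk).trans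
        (Metric.cthickening_subset_of_subset _ subset_closure)).trans_lt hAδ
  have hcountC : volume C ≤
      ((meeting (t * ε) C).encard : ℝ≥0∞) * ENNReal.ofReal (t * ε) ^ d :=
    volume_le_encard_mul (subset_biUnion_meeting (by positivity) C)
  have hfin : (meeting ε A).Finite := by
    by_contra hinf
    rw [Set.Infinite.encard_eq hinf] at hcountA
    simp [ENNReal.top_mul hεd] at hcountA
  -- Otherwise the large cubes covering `C` would have total measure at most `t ^ d * m`, contrary
  -- to the choice of `t`.
  have hle : (meeting ε A).encard ≤ (meeting (t * ε) C).encard := by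
    by_contra! hlt
    have h1 : ((meeting (t * ε) C).encard : ℝ≥0∞) ≤ ((meeting ε A).encard : ℝ≥0∞) := by
      exact_mod_cast hlt.le
    have h2 : volume C ≤ ENNReal.ofReal t ^ d * m := by
      calc volume C ≤ _ := hcountC
        _ ≤ ((meeting ε A).encard : ℝ≥0∞) * ENNReal.ofReal (t * ε) ^ d := by gcongr
        _ = ENNReal.ofReal t ^ d * (((meeting ε A).encard : ℝ≥0∞) * ENNReal.ofReal ε ^ d) := by
          rw [ENNReal.ofReal_mul ht0.le, mul_pow]; ring
        _ ≤ _ := by gcongr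
    exact absurd h2 (not_le.2 htC)
  obtain ⟨f, hfm, hfi⟩ := hfin.exists_injOn_of_encard_le hle
  choose g hg hgs using fun k : Fin d → ℤ => exists_vadd_cube_subset hG
    (show ε < t * ε by nlinarith) (gridPoint ε k) (gridPoint (t * ε) (f k))
  have := hfin.fintype
  let e := (Fintype.equivFin (meeting ε A)).symm
  refine ⟨Fintype.card (meeting ε A), fun i => A ∩ cube ε (gridPoint ε (e i)),
    fun i => g (e i), fun i => riemannMeasurable_inter hA
      ((convex_cube _ _).addHaar_frontier _), ?_, ?_, fun i => hg _, ?_, ?_⟩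
  · intro i j hij
    exact (pairwise_disjoint_cube hε (fun h => hij (e.injective (Subtype.ext h)))).mono
      inter_subset_right inter_subset_right
  · rw [← inter_iUnion, inter_eq_left]
    intro x hx
    obtain ⟨k, hk, hxk⟩ := mem_iUnion₂.1 (subset_biUnion_meeting hε A hx)
    exact mem_iUnion.2 ⟨e.symm ⟨k, hk⟩, by simpa using hxk⟩
  · intro i j hij
    refine (pairwise_disjoint_cube (show 0 < t * ε by positivity)
      (fun h => hij (e.injective (Subtype.ext (hfi (e i).2 (e j).2 h))))).mono ?_ ?_
    · exact (vadd_set_mono inter_subset_right).trans (hgs _)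
    · exact (vadd_set_mono inter_subset_right).trans (hgs _)
  · intro i
    exact (vadd_set_mono inter_subset_right).trans ((hgs _).trans
      ((cube_subset_cthickening (by positivity) hε₂ (hfm (e i).2)).trans hCδ))

/-! ### Riemann measurable sets and equidecomposition -/

lemma RiemannMeasurable.nullMeasurableSet {A : Set (EuclideanSpace ℝ (Fin d))}
    (hA : RiemannMeasurable A) : NullMeasurableSet A volume :=
  nullMeasurableSet_of_null_frontier hA.2

lemma RiemannMeasurable.union {A B : Set (EuclideanSpace ℝ (Fin d))} (hA : RiemannMeasurable A)
    (hB : RiemannMeasurable B) : RiemannMeasurable (A ∪ B) := by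
  refine ⟨hA.1.union hB.1, ?_⟩
  rw [← frontier_compl, compl_union]
  exact null_frontier_inter (by rw [frontier_compl, hA.2]) (by rw [frontier_compl, hB.2])

lemma RiemannMeasurable.diff {A B : Set (EuclideanSpace ℝ (Fin d))} (hA : RiemannMeasurable A)
    (hB : RiemannMeasurable B) : RiemannMeasurable (A \ B) :=
  riemannMeasurable_inter hA (B := Bᶜ) (by rw [frontier_compl, hB.2])

lemma RiemannMeasurable.iUnion {ι : Type*} [Finite ι] {A : ι → Set (EuclideanSpace ℝ (Fin d))}
    (hA : ∀ i, RiemannMeasurable (A i)) : RiemannMeasurable (⋃ i, A i) := by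
  have h : ∀ s : Set ι, s.Finite → RiemannMeasurable (⋃ i ∈ s, A i) := by
    intro s hs
    induction s, hs using Set.Finite.induction_on with
    | empty => simp [RiemannMeasurable]
    | insert _ _ ih => rw [biUnion_insert]; exact (hA _).union ih
  simpa using h univ finite_univ

lemma RiemannMeasurable.vadd {A : Set (EuclideanSpace ℝ (Fin d))} (hA : RiemannMeasurable A)
    (v : EuclideanSpace ℝ (Fin d)) : RiemannMeasurable (v +ᵥ A) := by
  refine ⟨hA.1.vadd v, ?_⟩
  have h : frontier (v +ᵥ A) = v +ᵥ frontier A :=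
    ((Homeomorph.addLeft v).image_frontier A).symm
  rw [h, measure_vadd, hA.2]

lemma EquidecomposableByTranslations.of_finite {G : AddSubgroup (EuclideanSpace ℝ (Fin d))}
    {S S' : Set (EuclideanSpace ℝ (Fin d))} {ι : Type*} [Finite ι]
    (A : ι → Set (EuclideanSpace ℝ (Fin d))) (v : ι → EuclideanSpace ℝ (Fin d))
    (hA : ∀ i, RiemannMeasurable (A i)) (hd : Pairwise (Function.onFun Disjoint A))
    (hS : (⋃ i, A i) = S) (hv : ∀ i, v i ∈ G)
    (hd' : Pairwise (Function.onFun Disjoint fun i => v i +ᵥ A i))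
    (hS' : (⋃ i, v i +ᵥ A i) = S') : EquidecomposableByTranslations G S S' := by
  let e := (Finite.equivFin ι).symm
  refine ⟨Nat.card ι, A ∘ e, v ∘ e, fun i => hA _, fun i j hij => hd (e.injective.ne hij), ?_,
    fun i => hv _, fun i j hij => (hd' (e.injective.ne hij)).aedisjoint, ?_⟩
  · rw [← hS]
    exact e.surjective.iUnion_comp A
  · rw [← hS']
    exact (e.surjective.iUnion_comp fun i => v i +ᵥ A i).eventuallyEq

lemma EquidecomposableByTranslations.volume_eq {G : AddSubgroup (EuclideanSpace ℝ (Fin d))}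
    {S S' : Set (EuclideanSpace ℝ (Fin d))} (h : EquidecomposableByTranslations G S S') :
    volume S = volume S' := by
  obtain ⟨N, A, v, hA, hd, rfl, -, hd', hS'⟩ := h
  rw [← measure_congr hS', measure_iUnion₀ (fun i j hij => (hd hij).aedisjoint)
    fun i => (hA i).nullMeasurableSet, measure_iUnion₀ hd'
    fun i => ((hA i).vadd _).nullMeasurableSet]
  simp only [measure_vadd]

/-- Two packings suffice, with no Cantor–Bernstein argument: the second one packs exactly the part
of `P` left free by the first, and it fits because `|P| - |A| < |U| - |closure A|`. -/
theorem exists_equidecomposable_between {G : AddSubgroup (EuclideanSpace ℝ (Fin d))}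
    (hG : Dense (G : Set (EuclideanSpace ℝ (Fin d)))) {K U P : Set (EuclideanSpace ℝ (Fin d))}
    (hP : RiemannMeasurable P) (hK : IsCompact K) (hU : IsOpen U) (hKU : K ⊆ U)
    (hKP : volume K < volume P) (hPU : volume P < volume U) :
    ∃ S, RiemannMeasurable S ∧ K ⊆ S ∧ S ⊆ U ∧ volume S = volume P ∧
      EquidecomposableByTranslations G S P := by
  obtain ⟨δ, hδ, hδU, hδP⟩ : ∃ δ, 0 < δ ∧ Metric.cthickening δ K ⊆ U ∧
      volume (Metric.cthickening δ K) < volume P := by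
    obtain ⟨δ₁, hδ₁, hδU⟩ := hK.exists_cthickening_subset_open hU hKU
    obtain ⟨δ, h1, h2⟩ := ((((tendsto_measure_cthickening_of_isCompact (μ := volume)
      hK).eventually_lt_const hKP).filter_mono nhdsWithin_le_nhds).and
      (Ioc_mem_nhdsGT hδ₁)).exists (f := nhdsWithin 0 (Ioi 0))
    exact ⟨δ, h2.1, (Metric.cthickening_mono h2.2 K).trans hδU, h1⟩
  -- The frontiers of the thickenings of `K` for distinct radii are disjoint, so some radius below
  -- `δ` gives a null frontier.
  obtain ⟨r, hr, hfr⟩ := exists_null_frontier_thickening volume K hδ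
  set A := Metric.thickening r K with hA
  have hAδ : closure A ⊆ Metric.cthickening δ K :=
    (Metric.closure_thickening_subset_cthickening r K).trans (Metric.cthickening_mono hr.2.le K)
  have hAR : RiemannMeasurable A := ⟨hK.isBounded.thickening, hfr⟩
  have hKA : K ⊆ A := Metric.self_subset_thickening hr.1 K
  have hAP : volume A < volume (interior P) := by
    rw [measure_interior_of_null_frontier hP.2]
    exact (measure_mono (subset_closure.trans hAδ)).trans_lt hδP
  obtain ⟨N, B, v, hB, hBd, hBA, hv, hvd, hvP⟩ :=
    embedsByTranslations_of_volume_lt hG hAR isOpen_interior hAP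
  have hBR : RiemannMeasurable (⋃ i, v i +ᵥ B i) := .iUnion fun i => (hB i).vadd _
  set Q := P \ ⋃ i, v i +ᵥ B i with hQ
  have hQR : RiemannMeasurable Q := hP.diff hBR
  have hBP : (⋃ i, v i +ᵥ B i) ⊆ P := iUnion_subset fun i => (hvP i).trans interior_subset
  have hvolB : volume (⋃ i, v i +ᵥ B i) = volume A :=
    (EquidecomposableByTranslations.of_finite B v hB hBd hBA hv hvd rfl).volume_eq.symm
  have hAtop : volume A ≠ ∞ := hAR.1.measure_lt_top.ne
  have hQV : volume Q < volume (U \ closure A) := by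
    have h1 : volume A + volume Q = volume P := by
      rw [← hvolB, ← measure_inter_add_sdiff₀ P hBR.nullMeasurableSet, inter_eq_right.2 hBP]
    have h2 : volume A + volume (U \ closure A) = volume U := by
      rw [← measure_closure_of_null_frontier hfr,
        ← measure_inter_add_sdiff U (isClosed_closure (s := A)).measurableSet,
        inter_eq_right.2 (hAδ.trans hδU)]
    rw [← h1, ← h2] at hPU
    exact lt_of_add_lt_add_left hPU
  obtain ⟨M, C, u, hC, hCd, hCQ, hu, hud, huV⟩ :=
    embedsByTranslations_of_volume_lt hG hQR (hU.sdiff isClosed_closure) hQV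
  have heq : EquidecomposableByTranslations G (A ∪ ⋃ j, u j +ᵥ C j) P := by
    -- The pieces of `A` move forward into `P`; the pieces placed in `U` move back by `-u j` to fill
    -- `Q`.
    refine .of_finite (ι := Fin N ⊕ Fin M) (Sum.elim B fun j => u j +ᵥ C j)
      (Sum.elim v fun j => -u j) ?_ ?_ ?_ ?_ ?_ ?_
    · rintro (i | j)
      exacts [hB i, (hC j).vadd _]
    · have key : ∀ i j, Disjoint (B i) (u j +ᵥ C j) := fun i j =>
        Set.disjoint_left.2 fun x hx hx' =>
          (huV j hx').2 (subset_closure (hBA ▸ mem_iUnion_of_mem i hx))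
      rintro (i | i) (j | j) hij
      · exact hBd fun h => hij (congrArg _ h)
      · exact key i j
      · exact (key j i).symm
      · exact hud fun h => hij (congrArg _ h)
    · simp [iUnion_sum, hBA]
    · rintro (i | j)
      exacts [hv i, neg_mem (hu j)]
    · have key : ∀ i j, Disjoint (v i +ᵥ B i) (C j) := fun i j =>
        Set.disjoint_left.2 fun x hx hx' => by
          have hxQ : x ∈ Q := hCQ ▸ mem_iUnion_of_mem j hx'
          exact hxQ.2 (mem_iUnion_of_mem i hx)
      rintro (i | i) (j | j) hij
      · exact hvd fun h => hij (congrArg _ h)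
      · simpa [Function.onFun] using key i j
      · simpa [Function.onFun] using (key j i).symm
      · simpa [Function.onFun] using hCd fun h => hij (congrArg _ h)
    · simp [iUnion_sum, hCQ, hQ, hBP]
  exact ⟨_, hAR.union (.iUnion fun j => (hC j).vadd _), hKA.trans subset_union_left,
    union_subset (subset_closure.trans (hAδ.trans hδU))
      (iUnion_subset fun j => (huV j).trans sdiff_subset), heq.volume_eq, heq⟩

/-! ### Dual basis and the volume of dual parallelepipeds -/

instance : (volume : Measure (EuclideanSpace ℝ (Fin d) × ℝ)).IsAddHaarMeasure :=
  inferInstanceAs ((volume : Measure (EuclideanSpace ℝ (Fin d))).prod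
    (volume : Measure ℝ)).IsAddHaarMeasure

/-- Coordinates on `ℝᵈ × ℝ`, the last factor first. -/
noncomputable def coord (d : ℕ) : (EuclideanSpace ℝ (Fin d) × ℝ) ≃ₗ[ℝ] (Fin (d + 1) → ℝ) where
  toFun p := Fin.cons p.2 p.1
  invFun x := (WithLp.toLp 2 (Fin.tail x), x 0)
  map_add' p q := by
    ext i
    refine Fin.cases ?_ (fun j => ?_) i <;> simp
  map_smul' c p := by
    ext i
    refine Fin.cases ?_ (fun j => ?_) i <;> simp
  left_inv p := by simp
  right_inv x := by simp

@[simp] lemma coord_zero (p : EuclideanSpace ℝ (Fin d) × ℝ) : coord d p 0 = p.2 := rfl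

@[simp] lemma coord_succ (p : EuclideanSpace ℝ (Fin d) × ℝ) (i : Fin d) :
    coord d p i.succ = p.1 i := rfl

@[simp] lemma coord_symm_fst (x : Fin (d + 1) → ℝ) (i : Fin d) :
    ((coord d).symm x).1 i = x i.succ := rfl

lemma inner_add_mul_eq_dotProduct (x y : EuclideanSpace ℝ (Fin d) × ℝ) :
    ⟪x.1, y.1⟫ + x.2 * y.2 = coord d x ⬝ᵥ coord d y := by
  simp [dotProduct, Fin.sum_univ_succ, PiLp.inner_apply, mul_comm, add_comm]

/-- The standard basis of `ℝᵈ × ℝ`, the last vector first. -/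
noncomputable def stdBasis (d : ℕ) :
    Module.Basis (Fin (d + 1)) ℝ (EuclideanSpace ℝ (Fin d) × ℝ) :=
  .ofEquivFun (coord d)

lemma volume_fundamentalDomain_stdBasis :
    volume (ZSpan.fundamentalDomain (stdBasis d)) = 1 := by
  have h : ZSpan.fundamentalDomain (stdBasis d) =
      cube 1 (0 : EuclideanSpace ℝ (Fin d)) ×ˢ Ico (0 : ℝ) 1 := by
    ext p
    simp [ZSpan.fundamentalDomain, cube, Fin.forall_fin_succ, stdBasis, and_comm]
  rw [h, Measure.volume_eq_prod, Measure.prod_prod, volume_cube]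
  simp

variable {Γ : Submodule ℤ (EuclideanSpace ℝ (Fin d) × ℝ)}

/-- The matrix whose rows are the coordinates of a family of vectors of `ℝᵈ × ℝ`. -/
noncomputable def rowMatrix (e : Fin (d + 1) → EuclideanSpace ℝ (Fin d) × ℝ) :
    Matrix (Fin (d + 1)) (Fin (d + 1)) ℝ :=
  Matrix.of fun i => coord d (e i)

lemma covolume_eq_abs_det [DiscreteTopology Γ] [IsZLattice ℝ Γ]
    (e : Module.Basis (Fin (d + 1)) ℤ Γ) :
    ZLattice.covolume Γ = |(rowMatrix fun i => (e i : EuclideanSpace ℝ (Fin d) × ℝ)).det| := by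
  rw [ZLattice.covolume_eq_det_mul_measureReal Γ volume e (stdBasis d), measureReal_def,
    volume_fundamentalDomain_stdBasis, Module.Basis.det_apply, ← Matrix.det_transpose]
  simp only [ENNReal.toReal_one, mul_one]
  congr 2

/-- The dual basis of a basis of a lattice in `ℝᵈ × ℝ`. -/
noncomputable def dualFamily (e : Fin (d + 1) → EuclideanSpace ℝ (Fin d) × ℝ)
    (j : Fin (d + 1)) : EuclideanSpace ℝ (Fin d) × ℝ :=
  (coord d).symm fun k => (rowMatrix e)⁻¹ k j

lemma dotProduct_dualFamily {e : Fin (d + 1) → EuclideanSpace ℝ (Fin d) × ℝ}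
    (he : (rowMatrix e).det ≠ 0) (i j : Fin (d + 1)) :
    coord d (e i) ⬝ᵥ coord d (dualFamily e j) = if i = j then 1 else 0 := by
  have h := congrFun (congrFun (Matrix.mul_nonsing_inv (rowMatrix e) he.isUnit) i) j
  rw [Matrix.one_apply, Matrix.mul_apply] at h
  simpa [dotProduct, dualFamily, rowMatrix] using h

lemma dualFamily_mem (e : Module.Basis (Fin (d + 1)) ℤ Γ)
    (he : (rowMatrix fun i => (e i : EuclideanSpace ℝ (Fin d) × ℝ)).det ≠ 0) (j : Fin (d + 1)) :
    dualFamily (fun i => (e i : EuclideanSpace ℝ (Fin d) × ℝ)) j ∈ dualLattice Γ := by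
  intro x hx
  refine ⟨e.repr ⟨x, hx⟩ j, ?_⟩
  have h : x = ∑ i, (e.repr ⟨x, hx⟩ i : ℝ) • (e i : EuclideanSpace ℝ (Fin d) × ℝ) := by
    have := congrArg Subtype.val (e.sum_repr ⟨x, hx⟩)
    simp only [Submodule.coe_sum, Submodule.coe_smul] at this
    simpa only [Int.cast_smul_eq_zsmul] using this.symm
  generalize e.repr ⟨x, hx⟩ = c at h
  rw [inner_add_mul_eq_dotProduct, h, map_sum, sum_dotProduct]
  simp [smul_dotProduct, dotProduct_dualFamily he]

/-- The determinant is the minor of `(rowMatrix e)⁻¹` without row `0` and column `i₀`, so up to sign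
it is an entry of the adjugate of that inverse, which is `rowMatrix e` divided by its determinant.
The entry `(i₀, 0)` of `rowMatrix e` is `(e i₀).2`. -/
lemma abs_det_dualFamily {e : Fin (d + 1) → EuclideanSpace ℝ (Fin d) × ℝ}
    (he : (rowMatrix e).det ≠ 0) (i₀ : Fin (d + 1)) :
    |(Matrix.of fun j k : Fin d => (dualFamily e (i₀.succAbove k)).1 j).det| =
      |(e i₀).2| / |(rowMatrix e).det| := by
  have hu : IsUnit (rowMatrix e).det := he.isUnit
  have h := Matrix.adjugate_fin_succ_eq_det_submatrix (rowMatrix e)⁻¹ i₀ 0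
  have h2 : (rowMatrix e)⁻¹.adjugate = (rowMatrix e)⁻¹.det • rowMatrix e := by
    have h3 := Matrix.inv_def (rowMatrix e)⁻¹
    rw [Matrix.nonsing_inv_nonsing_inv _ hu] at h3
    have hu' : IsUnit (rowMatrix e)⁻¹.det := Matrix.isUnit_nonsing_inv_det _ hu
    conv_rhs => enter [2]; rw [h3]
    rw [smul_smul, Ring.mul_inverse_cancel _ hu', one_smul]
  have h3 : (rowMatrix e)⁻¹.submatrix (Fin.succAbove 0) i₀.succAbove =
      Matrix.of fun j k : Fin d => (dualFamily e (i₀.succAbove k)).1 j := by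
    ext j k
    simp [dualFamily]
  rw [h2, h3] at h
  have h4 := congrArg abs h
  rw [abs_mul, abs_pow, abs_neg, abs_one, one_pow, one_mul] at h4
  rw [← h4, Matrix.smul_apply, Matrix.det_nonsing_inv, Ring.inverse_eq_inv', smul_eq_mul, abs_mul,
    abs_inv, div_eq_inv_mul]
  rfl

lemma exists_basis_zsmul_eq [DiscreteTopology Γ] [IsZLattice ℝ Γ] (γ : Γ) (hγ : γ ≠ 0) :
    ∃ (e : Module.Basis (Fin (d + 1)) ℤ Γ) (i₀ : Fin (d + 1)) (n : ℤ), γ = n • e i₀ := by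
  have hrank : Module.finrank ℤ Γ = d + 1 := by
    rw [ZLattice.rank ℝ Γ]
    simp
  let b : Module.Basis (Fin (d + 1)) ℤ Γ := Module.finBasisOfFinrankEq ℤ Γ hrank
  obtain ⟨n, s⟩ := Submodule.smithNormalForm b (Submodule.span ℤ {γ})
  -- The submodule `ℤγ` has rank one, so its Smith normal form relates its generator to a single
  -- basis vector of `Γ`.
  have hn : n = 1 := by
    have h1 := (LinearEquiv.toSpanNonzeroSingleton ℤ Γ γ hγ).finrank_eq
    rw [Module.finrank_eq_card_basis s.bN] at h1
    simpa using h1.symm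
  subst hn
  have hm := s.bN.sum_repr ⟨γ, Submodule.mem_span_singleton_self γ⟩
  have hm' := congrArg Subtype.val hm
  simp only [Finset.univ_unique, Finset.sum_singleton, Submodule.coe_smul, s.snf, smul_smul] at hm'
  exact ⟨s.bM, _, _, hm'.symm⟩

lemma volume_parallelepiped (v : Fin d → EuclideanSpace ℝ (Fin d)) :
    volume (parallelepiped v) = ENNReal.ofReal |(Matrix.of fun j k : Fin d => v k j).det| := by
  rw [← (EuclideanSpace.basisFun (Fin d) ℝ).addHaar_eq_volume, Measure.addHaar_parallelepiped,
    Module.Basis.det_apply]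
  rfl

theorem exists_dual_parallelepiped [DiscreteTopology Γ] [IsZLattice ℝ Γ] (hd : d ≠ 0)
    {γ : EuclideanSpace ℝ (Fin d) × ℝ} (hγ : γ ∈ Γ) (hpos : 0 < γ.2) :
    ∃ v : Fin d → EuclideanSpace ℝ (Fin d), (∀ i, v i ∈ dualProj Γ) ∧ LinearIndependent ℝ v ∧
      volume (parallelepiped v) = ENNReal.ofReal (γ.2 / ZLattice.covolume Γ) := by
  obtain ⟨e, i₀, n, hn⟩ := exists_basis_zsmul_eq (⟨γ, hγ⟩ : Γ) (by
    intro h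
    have : γ = 0 := congrArg Subtype.val h
    simp [this] at hpos)
  have hcov := ZLattice.covolume_pos Γ volume
  have he : (rowMatrix fun i => (e i : EuclideanSpace ℝ (Fin d) × ℝ)).det ≠ 0 := by
    rw [covolume_eq_abs_det e] at hcov
    exact abs_pos.1 hcov
  set f := dualFamily fun i => (e i : EuclideanSpace ℝ (Fin d) × ℝ) with hf
  have hγ2 : γ.2 = n * (e i₀ : EuclideanSpace ℝ (Fin d) × ℝ).2 := by
    have := congrArg (fun x : Γ => (x : EuclideanSpace ℝ (Fin d) × ℝ).2) hn
    simpa using this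
  -- One edge absorbs the factor `n`, which turns `|(e i₀).2|` into `γ.2` in the determinant; this
  -- needs `d ≠ 0`.
  let k₀ : Fin d := ⟨0, Nat.pos_of_ne_zero hd⟩
  let c : Fin d → ℤ := fun k => if k = k₀ then n else 1
  let v : Fin d → EuclideanSpace ℝ (Fin d) := fun k => c k • (f (i₀.succAbove k)).1
  have hdet : |(Matrix.of fun j k : Fin d => v k j).det| = γ.2 / ZLattice.covolume Γ := by
    have h1 : (Matrix.of fun j k : Fin d => v k j) = Matrix.of fun j k : Fin d =>
        (c k : ℝ) * (Matrix.of fun j k : Fin d => (f (i₀.succAbove k)).1 j) j k := by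
      ext j k
      simp [v]
    have h2 : ∏ k, (c k : ℝ) = n := by
      rw [Finset.prod_eq_single k₀] <;> simp +contextual [c]
    rw [h1, Matrix.det_mul_row, h2, abs_mul, hf, abs_det_dualFamily he, covolume_eq_abs_det e,
      ← mul_div_assoc, ← abs_mul, ← hγ2, abs_of_pos hpos]
  refine ⟨v, fun k => ?_, ?_, ?_⟩
  · exact ⟨c k • f (i₀.succAbove k), zsmul_mem (dualFamily_mem e he _) _, rfl⟩
  · have h : IsUnit ((EuclideanSpace.basisFun (Fin d) ℝ).toBasis.det v) := by
      rw [isUnit_iff_ne_zero, ← abs_pos, Module.Basis.det_apply]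
      exact hdet.symm ▸ div_pos hpos hcov
    exact ((Module.Basis.is_basis_iff_det _).2 h).1
  · rw [volume_parallelepiped, hdet]

/-! ### Non-dense subgroups of a Euclidean space -/

section ClosedSubgroup

variable {E : Type*} [NormedAddCommGroup E] [InnerProductSpace ℝ E] [FiniteDimensional ℝ E]

/-- The largest real subspace contained in an additive subgroup. -/
def linealitySpace (H : AddSubgroup E) : Submodule ℝ E where
  carrier := {v | ∀ t : ℝ, t • v ∈ H}
  zero_mem' t := by simp
  add_mem' hv hw t := by rw [smul_add]; exact add_mem (hv t) (hw t)
  smul_mem' c v hv t := by rw [smul_smul]; exact hv _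

/-- Near the origin a closed subgroup has no nonzero vectors orthogonal to all the lines it
contains. -/
lemma exists_pos_forall_norm_lt_eq_zero (H : AddSubgroup E) (hH : IsClosed (H : Set E)) :
    ∃ ε > 0, ∀ h ∈ H, h ∈ (linealitySpace H)ᗮ → ‖h‖ < ε → h = 0 := by
  by_contra! hcon
  choose h hmem horth hlt hne using fun n : ℕ =>
    hcon (1 / ((n : ℝ) + 1)) Nat.one_div_pos_of_nat
  have hpos : ∀ n, 0 < ‖h n‖ := fun n => norm_pos_iff.2 (hne n)
  have hlim : Tendsto (fun n => ‖h n‖) atTop (nhds 0) :=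
    squeeze_zero (fun n => norm_nonneg _) (fun n => (hlt n).le)
      tendsto_one_div_add_atTop_nhds_zero_nat
  -- Short vectors of `H` accumulate in a unit direction `v`. Their integer multiples approximate
  -- every `t • v`, so the whole line lies in the closed group, although `v` is orthogonal to all
  -- such lines.
  obtain ⟨v, hv, φ, hφ, hφv⟩ := (isCompact_sphere (0 : E) 1).tendsto_subseq
    (x := fun n => ‖h n‖⁻¹ • h n) fun n => by simp [norm_smul, (hpos n).ne']
  have hvorth : v ∈ (linealitySpace H)ᗮ :=
    (Submodule.isClosed_orthogonal _).mem_of_tendsto hφv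
      (Eventually.of_forall fun n => Submodule.smul_mem _ _ (horth _))
  have hvH : v ∈ linealitySpace H := by
    intro t
    have hround : Tendsto (fun n => (⌊t / ‖h (φ n)‖⌋ : ℝ) * ‖h (φ n)‖) atTop (nhds t) := by
      have hlim' := hlim.comp hφ.tendsto_atTop
      refine tendsto_of_tendsto_of_tendsto_of_le_of_le (g := fun n => t - ‖h (φ n)‖)
        (by simpa using tendsto_const_nhds.sub hlim') tendsto_const_nhds (fun n => ?_) fun n => ?_
      · have := Int.lt_floor_add_one (t / ‖h (φ n)‖)
        rw [div_lt_iff₀ (hpos _)] at this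
        dsimp only
        linarith
      · exact (le_div_iff₀ (hpos _)).1 (Int.floor_le _)
    refine hH.mem_of_tendsto (hround.smul hφv) (Eventually.of_forall fun n => ?_)
    have : ((⌊t / ‖h (φ n)‖⌋ : ℝ) * ‖h (φ n)‖) • (‖h (φ n)‖⁻¹ • h (φ n)) =
        ⌊t / ‖h (φ n)‖⌋ • h (φ n) := by
      rw [smul_smul, mul_assoc, mul_inv_cancel₀ (hpos _).ne', mul_one, Int.cast_smul_eq_zsmul]
    simp only [Function.comp_apply, this]
    exact zsmul_mem (hmem _) _
  have : v = 0 :=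
    Submodule.disjoint_def.1 (Submodule.orthogonal_disjoint (linealitySpace H)) v hvH hvorth
  simp [this] at hv

/-- A subgroup of a Euclidean space which is not dense lies in the preimage of `ℤ` under a nonzero
linear functional. -/
theorem exists_linearMap_int_of_not_dense (H : AddSubgroup E) (hH : ¬ Dense (H : Set E)) :
    ∃ φ : E →ₗ[ℝ] ℝ, φ ≠ 0 ∧ ∀ h ∈ H, ∃ n : ℤ, φ h = n := by
  by_cases hspan : Submodule.span ℝ (H : Set E) = ⊤
  swap
  · obtain ⟨φ, hφ, hker⟩ := Submodule.exists_le_ker_of_lt_top _ (lt_top_iff_ne_top.2 hspan)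
    exact ⟨φ, hφ, fun h hh => ⟨0, by simpa using hker (Submodule.subset_span hh)⟩⟩
  set C := H.topologicalClosure with hC
  have hCcl : IsClosed (C : Set E) := H.isClosed_topologicalClosure
  set V := linealitySpace C with hV
  have hVC : ∀ v ∈ V, v ∈ C := fun v hv => by simpa using hv 1
  have hVtop : V ≠ ⊤ := by
    intro h
    refine hH fun x => ?_
    have : x ∈ C := hVC x (h ▸ Submodule.mem_top)
    exact this
  -- The closure `C` splits as `V` plus the discrete group `C ∩ Vᗮ`. When `H` spans, the latter is a
  -- lattice in `Vᗮ ≠ 0`, and a coordinate in one of its bases, composed with the projection, is the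
  -- required functional.
  let L : Submodule ℤ Vᗮ := (AddSubgroup.comap Vᗮ.subtype.toAddMonoidHom C).toIntSubmodule
  have hL : ∀ x : Vᗮ, x ∈ L ↔ (x : E) ∈ C := fun x => Iff.rfl
  obtain ⟨ε, hε, hsmall⟩ := exists_pos_forall_norm_lt_eq_zero C hCcl
  have hdisc : DiscreteTopology L := by
    refine discreteTopology_of_isOpen_singleton_zero ?_
    rw [Metric.isOpen_singleton_iff]
    refine ⟨ε, hε, fun y hy => ?_⟩
    have h1 := hsmall ((y : Vᗮ) : E) ((hL _).1 y.2) (y : Vᗮ).2 (by simpa using hy)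
    exact Subtype.ext (Subtype.ext h1)
  have hproj : ∀ h ∈ H, Vᗮ.orthogonalProjectionOnto h ∈ L := by
    intro h hh
    rw [hL]
    have h1 : ((Vᗮ.orthogonalProjectionOnto h : Vᗮ) : E) = h - V.starProjection h := by
      rw [eq_sub_iff_add_eq']
      exact V.starProjection_add_starProjection_orthogonal h
    rw [h1]
    exact sub_mem (H.le_topologicalClosure hh) (hVC _ (V.starProjection_apply_mem h))
  have hlat : IsZLattice ℝ L := by
    refine ⟨eq_top_iff.2 ?_⟩
    have h1 : Submodule.map (Vᗮ.orthogonalProjectionOnto : E →L[ℝ] Vᗮ).toLinearMap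
        (Submodule.span ℝ (H : Set E)) = ⊤ := by
      rw [hspan, Submodule.map_top, LinearMap.range_eq_top]
      intro x
      exact ⟨x, by simp⟩
    rw [← h1, Submodule.map_span, Submodule.span_le]
    rintro _ ⟨h, hh, rfl⟩
    exact Submodule.subset_span (hproj h hh)
  let b := (Module.Free.chooseBasis ℤ L)
  let bR := b.ofZLatticeBasis ℝ L
  have : Nontrivial Vᗮ := by
    rw [Submodule.nontrivial_iff_ne_bot, Ne, Submodule.orthogonal_eq_bot_iff]
    exact hVtop
  obtain ⟨i⟩ := bR.index_nonempty
  refine ⟨bR.coord i ∘ₗ (Vᗮ.orthogonalProjectionOnto : E →L[ℝ] Vᗮ).toLinearMap, ?_, ?_⟩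
  · intro h
    have := LinearMap.congr_fun h (bR i : E)
    simp at this
  · intro h hh
    refine ⟨b.repr ⟨_, hproj h hh⟩ i, ?_⟩
    exact b.ofZLatticeBasis_repr_apply ℝ L ⟨_, hproj h hh⟩ i

end ClosedSubgroup

/-! ### Density of the projected dual lattice -/

/-- A nonzero functional `⟪u, ·⟫` with integer values on `p₁(Γ*)` makes `(u, 0)` pair integrally
with `Γ*`. Then `(u, 0) ∈ Γ` by biduality, and injectivity of `p₂` on `Γ` forces `u = 0`. -/
theorem dense_dualProj [DiscreteTopology Γ] [IsZLattice ℝ Γ] (hΓ : GeneralPosition Γ) :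
    Dense (dualProj Γ : Set (EuclideanSpace ℝ (Fin d))) := by
  by_contra hcon
  obtain ⟨φ, hφ, hint⟩ := exists_linearMap_int_of_not_dense _ hcon
  set u := (InnerProductSpace.toDual ℝ (EuclideanSpace ℝ (Fin d))).symm φ.toContinuousLinearMap
    with hu
  have huφ : ∀ x, ⟪u, x⟫ = φ x := fun x => by
    rw [hu, InnerProductSpace.toDual_symm_apply]
    rfl
  have hrank : Module.finrank ℤ Γ = d + 1 := by
    rw [ZLattice.rank ℝ Γ]
    simp
  let e : Module.Basis (Fin (d + 1)) ℤ Γ := Module.finBasisOfFinrankEq ℤ Γ hrank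
  let eR := e.ofZLatticeBasis ℝ Γ
  have he : (rowMatrix fun i => (e i : EuclideanSpace ℝ (Fin d) × ℝ)).det ≠ 0 := by
    have hcov := ZLattice.covolume_pos Γ volume
    rw [covolume_eq_abs_det e] at hcov
    exact abs_pos.1 hcov
  have hmem : ((u, 0) : EuclideanSpace ℝ (Fin d) × ℝ) ∈ Γ := by
    choose n hn using fun j => hint _ ⟨_, dualFamily_mem e he j, rfl⟩
    -- Coordinates in the basis `e` are pairings with the dual basis.
    have hcoef : ∀ j, eR.repr (u, 0) j = n j := by
      intro j
      have h1 := inner_add_mul_eq_dotProduct (u, 0)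
        (dualFamily (fun i => (e i : EuclideanSpace ℝ (Fin d) × ℝ)) j)
      conv_rhs at h1 => rw [← eR.sum_repr (u, 0)]
      rw [map_sum, sum_dotProduct] at h1
      simp only [map_smul, smul_dotProduct, eR, Module.Basis.ofZLatticeBasis_apply,
        dotProduct_dualFamily he] at h1
      rw [← hn j, AddMonoidHom.coe_fst, ← huφ]
      simpa using h1.symm
    rw [← eR.sum_repr (u, 0)]
    refine sum_mem fun j _ => ?_
    rw [hcoef, Int.cast_smul_eq_zsmul, Module.Basis.ofZLatticeBasis_apply]
    exact zsmul_mem (e j).2 _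
  have hu0 : ((u, 0) : EuclideanSpace ℝ (Fin d) × ℝ) = 0 :=
    hΓ.injOn_snd hmem Γ.zero_mem rfl
  refine hφ (LinearMap.ext fun x => ?_)
  rw [← huφ, show u = 0 from congrArg Prod.fst hu0]
  simp

/-! ### Uniform density of the model set -/

/-- A bounded measurable fundamental domain of a lattice, together with the map sending a point to
the lattice point of its cell. -/
lemma exists_fundamentalDomain_floor [DiscreteTopology Γ] [IsZLattice ℝ Γ] :
    ∃ (F : Set (EuclideanSpace ℝ (Fin d) × ℝ))
      (fl : EuclideanSpace ℝ (Fin d) × ℝ → EuclideanSpace ℝ (Fin d) × ℝ) (r : ℝ),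
      MeasurableSet F ∧ volume F = ENNReal.ofReal (ZLattice.covolume Γ) ∧ (∀ p ∈ F, ‖p‖ ≤ r) ∧
      ∀ p, fl p ∈ Γ ∧ ∀ γ ∈ Γ, p - γ ∈ F ↔ γ = fl p := by
  let e := Module.Free.chooseBasis ℤ Γ
  let eR := e.ofZLatticeBasis ℝ Γ
  have hspan : Submodule.span ℤ (Set.range eR) = Γ := e.ofZLatticeBasis_span ℝ
  obtain ⟨r, hr⟩ := (ZSpan.fundamentalDomain_isBounded eR).exists_norm_le
  refine ⟨ZSpan.fundamentalDomain eR, fun p => ZSpan.floor eR p, r,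
    ZSpan.fundamentalDomain_measurableSet eR, ?_, hr, fun p => ⟨?_, fun γ hγ => ?_⟩⟩
  · rw [ZLattice.covolume_eq_measure_fundamentalDomain Γ volume
      (ZLattice.isAddFundamentalDomain e volume), measureReal_def, ENNReal.ofReal_toReal]
    exact (ZSpan.fundamentalDomain_isBounded eR).measure_lt_top.ne
  · exact hspan.le (ZSpan.floor eR p).2
  · have hγ' : -γ ∈ Submodule.span ℤ (Set.range eR) := hspan.ge (neg_mem hγ)
    rw [← ZSpan.fract_eq_self, sub_eq_add_neg, ZSpan.fract_add_ZSpan eR p hγ', ZSpan.fract_apply,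
      sub_eq_add_neg, add_right_inj, neg_inj, eq_comm]

lemma existsUnique_add_zsmul_mem {a b : ℝ} (hab : a < b) {I : Set ℝ}
    (hI : I = Set.Ico a b ∨ I = Set.Ioc a b) (t : ℝ) : ∃! n : ℤ, t + n • (b - a) ∈ I := by
  rcases hI with rfl | rfl
  · simpa using existsUnique_add_zsmul_mem_Ico (sub_pos.2 hab) t a
  · simpa using existsUnique_add_zsmul_mem_Ioc (sub_pos.2 hab) t a

/-- Translation by `γ` raises `h` by exactly the length of `I`, so each orbit enters `I` once. It
serves both for the height of a point and for the height of the lattice point of its cell. -/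
lemma isAddFundamentalDomain_zmultiples {a b : ℝ} (hab : a < b) {I : Set ℝ}
    (hI : I = Set.Ico a b ∨ I = Set.Ioc a b) {γ : EuclideanSpace ℝ (Fin d) × ℝ}
    (h : EuclideanSpace ℝ (Fin d) × ℝ → ℝ)
    (hh : ∀ p (n : ℤ), h (p + n • γ) = h p + n • (b - a)) (hmeas : MeasurableSet {p | h p ∈ I}) :
    IsAddFundamentalDomain (AddSubgroup.zmultiples γ) {p | h p ∈ I} volume := by
  refine .mk' hmeas.nullMeasurableSet fun p => ?_
  obtain ⟨n, hn, huniq⟩ := existsUnique_add_zsmul_mem hab hI (h p)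
  refine ⟨⟨n • γ, n, rfl⟩, ?_, ?_⟩
  · change h (n • γ + p) ∈ I
    rwa [add_comm, hh]
  · rintro ⟨_, m, rfl⟩ hm
    change h (m • γ + p) ∈ I at hm
    rw [add_comm, hh] at hm
    exact Subtype.ext (congrArg (· • γ) (huniq m hm))

lemma volume_Ico_or_Ioc {a b : ℝ} {I : Set ℝ} (hI : I = Set.Ico a b ∨ I = Set.Ioc a b) :
    volume I = ENNReal.ofReal (b - a) := by
  rcases hI with rfl | rfl <;> simp

lemma measurableSet_Ico_or_Ioc {a b : ℝ} {I : Set ℝ} (hI : I = Set.Ico a b ∨ I = Set.Ioc a b) :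
    MeasurableSet I := by
  rcases hI with rfl | rfl
  exacts [measurableSet_Ico, measurableSet_Ioc]

/-- The oblique cylinder with direction `(w, 1)` over a ball. -/
def obliqueCylinder (w x : EuclideanSpace ℝ (Fin d)) (R : ℝ) :
    Set (EuclideanSpace ℝ (Fin d) × ℝ) :=
  {p | p.1 - p.2 • w ∈ Metric.ball x R}

lemma measurableSet_obliqueCylinder (w x : EuclideanSpace ℝ (Fin d)) (R : ℝ) :
    MeasurableSet (obliqueCylinder w x R) :=
  (Metric.isOpen_ball.preimage (by fun_prop :
    Continuous fun p : EuclideanSpace ℝ (Fin d) × ℝ => p.1 - p.2 • w)).measurableSet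

lemma volume_obliqueCylinder_inter (w x : EuclideanSpace ℝ (Fin d)) (R : ℝ) {I : Set ℝ}
    (hI : MeasurableSet I) :
    volume (obliqueCylinder w x R ∩ {p | p.2 ∈ I}) =
      volume I * volume (Metric.ball (0 : EuclideanSpace ℝ (Fin d)) R) := by
  have hmeas : MeasurableSet (obliqueCylinder w x R ∩ {p | p.2 ∈ I}) :=
    (measurableSet_obliqueCylinder w x R).inter (measurable_snd hI)
  rw [Measure.volume_eq_prod, Measure.prod_apply_symm hmeas, mul_comm,
    ← lintegral_indicator_const hI]
  refine lintegral_congr fun t => ?_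
  by_cases ht : t ∈ I
  · have : (fun y : EuclideanSpace ℝ (Fin d) => (y, t)) ⁻¹'
        (obliqueCylinder w x R ∩ {p | p.2 ∈ I}) = Metric.ball (x + t • w) R := by
      ext y
      simp [obliqueCylinder, ht, dist_eq_norm, sub_sub, add_comm]
    rw [this, indicator_of_mem ht, Measure.addHaar_ball_center]
  · have : (fun y : EuclideanSpace ℝ (Fin d) => (y, t)) ⁻¹'
        (obliqueCylinder w x R ∩ {p | p.2 ∈ I}) = ∅ := by
      ext y
      simp [ht]
    rw [this, indicator_of_notMem ht, measure_empty]

lemma encard_modelSet_inter (hΓ : GeneralPosition Γ) (I : Set ℝ)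
    (B : Set (EuclideanSpace ℝ (Fin d))) :
    (modelSet Γ I ∩ B).encard = {γ | γ ∈ Γ ∧ γ.2 ∈ I ∧ γ.1 ∈ B}.encard := by
  have h : modelSet Γ I ∩ B = Prod.fst '' {γ | γ ∈ Γ ∧ γ.2 ∈ I ∧ γ.1 ∈ B} := by
    ext x
    constructor
    · rintro ⟨⟨γ, hγ, hI, rfl⟩, hB⟩
      exact ⟨γ, ⟨hγ, hI, hB⟩, rfl⟩
    · rintro ⟨γ, ⟨hγ, hI, hB⟩, rfl⟩
      exact ⟨⟨γ, hγ, hI, rfl⟩, hB⟩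
  rw [h, (hΓ.injOn_fst.mono fun γ hγ => hγ.1).encard_image]

/-- The number of points of the model set in a ball differs from its expected value by a
bounded change of the radius. -/
theorem exists_encard_modelSet_bounds [DiscreteTopology Γ] [IsZLattice ℝ Γ]
    (hΓ : GeneralPosition Γ) {a b : ℝ} (hab : a < b) {I : Set ℝ}
    (hI : I = Set.Ico a b ∨ I = Set.Ioc a b) (hlen : ∃ γ ∈ Γ, γ.2 = b - a) :
    ∃ c : ℝ, ∀ x R,
      ((modelSet Γ I ∩ Metric.ball x R).encard : ℝ≥0∞) * ENNReal.ofReal (ZLattice.covolume Γ) ≤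
        ENNReal.ofReal (b - a) * volume (Metric.ball (0 : EuclideanSpace ℝ (Fin d)) (R + c)) ∧
      ENNReal.ofReal (b - a) * volume (Metric.ball (0 : EuclideanSpace ℝ (Fin d)) (R - c)) ≤
        ((modelSet Γ I ∩ Metric.ball x R).encard : ℝ≥0∞) *
          ENNReal.ofReal (ZLattice.covolume Γ) := by
  obtain ⟨γ₀, hγ₀, hlen⟩ := hlen
  obtain ⟨F, fl, r, hFm, hFv, hFr, hfl⟩ := exists_fundamentalDomain_floor (Γ := Γ)
  have hℓ : 0 < b - a := sub_pos.2 hab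
  have hIm := measurableSet_Ico_or_Ioc hI
  have hIb : ∀ t ∈ I, |t| ≤ max |a| |b| := by
    intro t ht
    have : t ∈ Icc a b := by
      rcases hI with rfl | rfl
      exacts [Ico_subset_Icc_self ht, Ioc_subset_Icc_self ht]
    exact abs_le_max_abs_abs this.1 this.2
  set m := max |a| |b|
  -- With this slope `γ₀ = (b - a) • (w, 1)`, so the oblique cylinders are invariant under `ℤγ₀`.
  set w := (b - a)⁻¹ • γ₀.1 with hw
  have hfl_self : ∀ p, p - fl p ∈ F := fun p => ((hfl p).2 _ (hfl p).1).2 rfl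
  have hfl_add : ∀ p, ∀ γ ∈ Γ, fl (p + γ) = fl p + γ := fun p γ hγ =>
    (((hfl (p + γ)).2 _ (add_mem (hfl p).1 hγ)).1 (by simpa using hfl_self p)).symm
  have hE : ∀ s : Set (EuclideanSpace ℝ (Fin d) × ℝ), s ⊆ Γ →
      {p | fl p ∈ s} = ⋃ γ ∈ s, γ +ᵥ F := by
    intro s hs
    ext p
    simp only [mem_ofPred_eq, mem_iUnion, mem_vadd_set_iff_neg_vadd_mem, vadd_eq_add, exists_prop]
    constructor
    · exact fun h => ⟨fl p, h, by simpa [neg_add_eq_sub] using hfl_self p⟩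
    · rintro ⟨γ, hγ, hp⟩
      rw [neg_add_eq_sub, (hfl p).2 γ (hs hγ)] at hp
      rwa [← hp]
  have hcountable : ∀ s : Set (EuclideanSpace ℝ (Fin d) × ℝ), s ⊆ Γ → s.Countable := fun s hs =>
    (Set.countable_coe_iff.1 (inferInstanceAs (Countable Γ))).mono hs
  have hmeas : ∀ s : Set (EuclideanSpace ℝ (Fin d) × ℝ), s ⊆ Γ → MeasurableSet {p | fl p ∈ s} := by
    intro s hs
    rw [hE s hs]
    exact .biUnion (hcountable s hs) fun γ _ => hFm.const_vadd γ
  have hvol : ∀ s : Set (EuclideanSpace ℝ (Fin d) × ℝ), s ⊆ Γ →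
      volume {p | fl p ∈ s} = (s.encard : ℝ≥0∞) * ENNReal.ofReal (ZLattice.covolume Γ) := by
    intro s hs
    rw [hE s hs, measure_biUnion (hcountable s hs) ?_ fun γ _ => hFm.const_vadd γ]
    · simp only [measure_vadd, hFv, ENNReal.tsum_set_const]
    · intro γ hγ γ' hγ' hne
      refine Set.disjoint_left.2 fun p hp hp' => hne ?_
      rw [mem_vadd_set_iff_neg_vadd_mem, vadd_eq_add, neg_add_eq_sub] at hp hp'
      rw [((hfl p).2 γ (hs hγ)).1 hp, ((hfl p).2 γ' (hs hγ')).1 hp']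
  have hset : {p | (fl p).2 ∈ I} = {p | fl p ∈ {γ | γ ∈ Γ ∧ γ.2 ∈ I}} := by
    ext p
    simp [(hfl p).1]
  have hdom₁ : IsAddFundamentalDomain (AddSubgroup.zmultiples γ₀)
      {p : EuclideanSpace ℝ (Fin d) × ℝ | p.2 ∈ I} volume :=
    isAddFundamentalDomain_zmultiples hab hI Prod.snd (fun p n => by simp [hlen])
      (measurable_snd hIm)
  have hdom₂ : IsAddFundamentalDomain (AddSubgroup.zmultiples γ₀) {p | (fl p).2 ∈ I} volume :=
    isAddFundamentalDomain_zmultiples hab hI (fun p => (fl p).2)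
      (fun p n => by simp [hfl_add p _ (zsmul_mem hγ₀ n), hlen])
      (hset ▸ hmeas _ fun γ hγ => hγ.1)
  have hinv : ∀ x R (g : AddSubgroup.zmultiples γ₀),
      (fun p => g +ᵥ p) ⁻¹' obliqueCylinder w x R = obliqueCylinder w x R := by
    rintro x R ⟨_, n, rfl⟩
    ext p
    have h1 : (n • γ₀ + p).1 - (n • γ₀ + p).2 • w = p.1 - p.2 • w := by
      have h2 : (b - a) • w = γ₀.1 := by
        rw [hw, smul_smul, mul_inv_cancel₀ hℓ.ne', one_smul]
      simp only [Prod.fst_add, Prod.snd_add, Prod.smul_fst, Prod.smul_snd, hlen, add_smul,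
        smul_assoc, h2]
      abel
    change (n • γ₀ + p).1 - (n • γ₀ + p).2 • w ∈ Metric.ball x R ↔ _
    rw [h1]
    rfl
  -- An invariant set meets any two fundamental domains of `ℤγ₀` in equal measure.
  have hmain : ∀ x R, volume (obliqueCylinder w x R ∩ {p | (fl p).2 ∈ I}) =
      ENNReal.ofReal (b - a) * volume (Metric.ball (0 : EuclideanSpace ℝ (Fin d)) R) := by
    intro x R
    rw [← hdom₁.measure_set_eq hdom₂ (measurableSet_obliqueCylinder w x R) (hinv x R),
      volume_obliqueCylinder_inter w x R hIm, volume_Ico_or_Ioc hI]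
  -- The cell has size at most `r` and the height of `p` is at most `m + r`, so sliding `p` along
  -- `(w, 1)` to height 0 ends within a fixed distance of `(fl p).1`.
  have hdist : ∀ p, (fl p).2 ∈ I → dist (p.1 - p.2 • w) (fl p).1 ≤ r + (m + r) * ‖w‖ := by
    intro p hp
    have h1 := hFr _ (hfl_self p)
    have h2 : ‖p.1 - (fl p).1‖ ≤ r := (norm_fst_le (p - fl p)).trans h1
    have h3 : ‖p.2 - (fl p).2‖ ≤ r := (norm_snd_le (p - fl p)).trans h1
    have h4 : ‖p.2‖ ≤ m + r := by
      have := norm_add_le (fl p).2 (p.2 - (fl p).2)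
      rw [add_sub_cancel] at this
      exact this.trans (add_le_add (hIb _ hp) h3)
    calc dist (p.1 - p.2 • w) (fl p).1 = ‖(p.1 - (fl p).1) - p.2 • w‖ := by
          rw [dist_eq_norm]; congr 1; abel
      _ ≤ ‖p.1 - (fl p).1‖ + ‖p.2 • w‖ := norm_sub_le _ _
      _ ≤ r + (m + r) * ‖w‖ := by rw [norm_smul]; gcongr
  refine ⟨r + (m + r) * ‖w‖, fun x R => ?_⟩
  rw [encard_modelSet_inter hΓ, ← hvol _ fun γ hγ => hγ.1, ← hmain x, ← hmain x]
  constructor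
  · refine measure_mono fun p hp => ⟨?_, hp.2.1⟩
    have h1 := hdist p hp.2.1
    have h2 := Metric.mem_ball.1 hp.2.2
    rw [obliqueCylinder, mem_ofPred_eq, Metric.mem_ball]
    linarith [dist_triangle (p.1 - p.2 • w) (fl p).1 x]
  · refine measure_mono fun p hp => ⟨(hfl p).1, hp.2, ?_⟩
    have h1 := hdist p hp.2
    have h2 := Metric.mem_ball.1 hp.1
    rw [Metric.mem_ball]
    rw [dist_comm] at h1
    linarith [dist_triangle (fl p).1 (p.1 - p.2 • w) x]

lemma tendsto_volume_ball_add_div (c : ℝ) :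
    Tendsto (fun R : ℝ => volume (Metric.ball (0 : EuclideanSpace ℝ (Fin d)) (R + c)) /
      volume (Metric.ball (0 : EuclideanSpace ℝ (Fin d)) R)) atTop (nhds 1) := by
  have h1 : Tendsto (fun R : ℝ => ENNReal.ofReal ((1 + c * R⁻¹) ^ d)) atTop (nhds 1) := by
    have h2 : Tendsto (fun R : ℝ => (1 + c * R⁻¹) ^ d) atTop (nhds ((1 + c * 0) ^ d)) :=
      ((tendsto_inv_atTop_zero.const_mul c).const_add 1).pow d
    simpa using ENNReal.tendsto_ofReal h2
  refine h1.congr' ?_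
  filter_upwards [eventually_gt_atTop 0, eventually_gt_atTop (-c)] with R hR hRc
  have hRc' : 0 < R + c := by linarith
  have hball : volume (Metric.ball (0 : EuclideanSpace ℝ (Fin d)) 1) ≠ 0 :=
    (Metric.measure_ball_pos _ _ one_pos).ne'
  rw [Measure.addHaar_ball_of_pos _ _ hRc', Measure.addHaar_ball_of_pos _ _ hR,
    ENNReal.mul_div_mul_right _ _ hball measure_ball_lt_top.ne,
    ← ENNReal.ofReal_div_of_pos (by positivity), finrank_euclideanSpace_fin, ← div_pow, add_div,
    div_self hR.ne', div_eq_mul_inv c]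

/-- The radius shift `c` does not depend on the centre, so the infimum and the supremum over `x` are
squeezed between the same limits. -/
theorem hasUniformDensity_modelSet [DiscreteTopology Γ] [IsZLattice ℝ Γ]
    (hΓ : GeneralPosition Γ) {a b : ℝ} (hab : a < b) {I : Set ℝ}
    (hI : I = Set.Ico a b ∨ I = Set.Ioc a b) (hlen : ∃ γ ∈ Γ, γ.2 = b - a) :
    HasUniformDensity (modelSet Γ I) (ENNReal.ofReal ((b - a) / ZLattice.covolume Γ)) := by
  obtain ⟨c, hc⟩ := exists_encard_modelSet_bounds hΓ hab hI hlen
  have hcov := ZLattice.covolume_pos Γ volume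
  have hcov0 : ENNReal.ofReal (ZLattice.covolume Γ) ≠ 0 := by simpa using hcov
  set D := ENNReal.ofReal ((b - a) / ZLattice.covolume Γ) with hD
  have hDeq : ∀ V : ℝ≥0∞, D * V =
      ENNReal.ofReal (b - a) * V / ENNReal.ofReal (ZLattice.covolume Γ) := by
    intro V
    rw [hD, ENNReal.ofReal_div_of_pos hcov, div_eq_mul_inv, div_eq_mul_inv]
    ring
  have hup : ∀ x R, ((modelSet Γ I ∩ Metric.ball x R).encard : ℝ≥0∞) ≤
      D * volume (Metric.ball (0 : EuclideanSpace ℝ (Fin d)) (R + c)) := by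
    intro x R
    rw [hDeq, ENNReal.le_div_iff_mul_le (Or.inl hcov0) (Or.inl ENNReal.ofReal_ne_top)]
    exact (hc x R).1
  have hlow : ∀ x R, D * volume (Metric.ball (0 : EuclideanSpace ℝ (Fin d)) (R + -c)) ≤
      ((modelSet Γ I ∩ Metric.ball x R).encard : ℝ≥0∞) := by
    intro x R
    rw [hDeq, ENNReal.div_le_iff hcov0 ENNReal.ofReal_ne_top, ← sub_eq_add_neg]
    exact (hc x R).2
  have hlim : ∀ c : ℝ, Tendsto (fun R : ℝ =>
      D * (volume (Metric.ball (0 : EuclideanSpace ℝ (Fin d)) (R + c)) /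
        volume (Metric.ball (0 : EuclideanSpace ℝ (Fin d)) R))) atTop (nhds D) := fun c => by
    simpa using ENNReal.Tendsto.const_mul (tendsto_volume_ball_add_div (d := d) c)
      (Or.inl one_ne_zero)
  have hle₁ : ∀ x R, D * (volume (Metric.ball (0 : EuclideanSpace ℝ (Fin d)) (R + -c)) /
      volume (Metric.ball (0 : EuclideanSpace ℝ (Fin d)) R)) ≤
      ((modelSet Γ I ∩ Metric.ball x R).encard : ℝ≥0∞) /
        volume (Metric.ball (0 : EuclideanSpace ℝ (Fin d)) R) := fun x R => by
    rw [← mul_div_assoc]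
    exact ENNReal.div_le_div_right (hlow x R) _
  have hle₂ : ∀ x R, ((modelSet Γ I ∩ Metric.ball x R).encard : ℝ≥0∞) /
      volume (Metric.ball (0 : EuclideanSpace ℝ (Fin d)) R) ≤
      D * (volume (Metric.ball (0 : EuclideanSpace ℝ (Fin d)) (R + c)) /
        volume (Metric.ball (0 : EuclideanSpace ℝ (Fin d)) R)) := fun x R => by
    rw [← mul_div_assoc]
    exact ENNReal.div_le_div_right (hup x R) _
  constructor
  · exact (tendsto_of_tendsto_of_tendsto_of_le_of_le (hlim (-c)) (hlim c)
      (fun R => le_iInf fun x => hle₁ x R)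
      (fun R => (iInf_le _ 0).trans (hle₂ 0 R))).liminf_eq
  · exact (tendsto_of_tendsto_of_tendsto_of_le_of_le (hlim (-c)) (hlim c)
      (fun R => (hle₁ 0 R).trans (le_iSup (fun x : EuclideanSpace ℝ (Fin d) =>
        ((modelSet Γ I ∩ Metric.ball x R).encard : ℝ≥0∞) /
          volume (Metric.ball (0 : EuclideanSpace ℝ (Fin d)) R)) 0))
      (fun R => iSup_le fun x => hle₂ x R)).limsup_eq

/-! ### Assembling the theorem -/

/-- For `d = 0`, injectivity of `p₁` would force `Γ = 0`, which does not span the line. -/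
lemma GeneralPosition.dim_ne_zero [DiscreteTopology Γ] [IsZLattice ℝ Γ] (hΓ : GeneralPosition Γ) : d ≠ 0 := by
  rintro rfl
  have h0 : (Γ : Set (EuclideanSpace ℝ (Fin 0) × ℝ)) ⊆ {0} := fun γ hγ =>
    hΓ.injOn_fst hγ Γ.zero_mem (Subsingleton.elim _ _)
  have h1 : Submodule.span ℝ (Γ : Set (EuclideanSpace ℝ (Fin 0) × ℝ)) = ⊤ :=
    IsZLattice.span_top
  have h2 : Submodule.span ℝ (Γ : Set (EuclideanSpace ℝ (Fin 0) × ℝ)) = ⊥ :=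
    Submodule.span_eq_bot.2 fun x hx => h0 hx
  exact bot_ne_top (h2.symm.trans h1)

lemma riemannMeasurable_parallelepiped (v : Fin d → EuclideanSpace ℝ (Fin d)) :
    RiemannMeasurable (parallelepiped v) := by
  constructor
  · rw [parallelepiped]
    exact (isCompact_Icc.image (by fun_prop)).isBounded
  · exact Convex.addHaar_frontier _ (convex_parallelepiped v)

end Quasicrystal

theorem mainTheorem5 (d : ℕ)
    (Γ : Submodule ℤ (EuclideanSpace ℝ (Fin d) × ℝ)) [DiscreteTopology Γ] [IsZLattice ℝ Γ]
    (hΓ : Quasicrystal.GeneralPosition Γ)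
    (a b : ℝ) (hab : a < b) (I : Set ℝ) (hI : I = Set.Ico a b ∨ I = Set.Ioc a b)
    (hlen : ∃ γ ∈ Γ, γ.2 = b - a) :
    Quasicrystal.HasUniformDensity (Quasicrystal.modelSet Γ I)
      (ENNReal.ofReal ((b - a) / ZLattice.covolume Γ)) ∧
    ∀ D : ℝ≥0∞, Quasicrystal.HasUniformDensity (Quasicrystal.modelSet Γ I) D →
    ∀ K U : Set (EuclideanSpace ℝ (Fin d)), IsCompact K → IsOpen U → K ⊆ U →
      volume K < D → D < volume U →
      ∃ S : Set (EuclideanSpace ℝ (Fin d)),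
        Quasicrystal.RiemannMeasurable S ∧ K ⊆ S ∧ S ⊆ U ∧
        volume S = D ∧
        ∃ v : Fin d → EuclideanSpace ℝ (Fin d),
          (∀ i, v i ∈ Quasicrystal.dualProj Γ) ∧
          LinearIndependent ℝ v ∧
          Quasicrystal.EquidecomposableByTranslations (Quasicrystal.dualProj Γ) S
            (parallelepiped v) := by
  have hdens := Quasicrystal.hasUniformDensity_modelSet hΓ hab hI hlen
  refine ⟨hdens, fun D hD K U hK hU hKU hKD hDU => ?_⟩
  obtain ⟨γ, hγ, hγlen⟩ := hlen
  obtain ⟨v, hv, hvind, hvol⟩ := Quasicrystal.exists_dual_parallelepiped hΓ.dim_ne_zero hγ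
    (hγlen.symm ▸ sub_pos.2 hab)
  -- Any uniform density equals `lowerDensity`, so it is the value just computed.
  have hDv : D = volume (parallelepiped v) := by
    rw [hvol, hγlen, ← hD.1, hdens.1]
  subst hDv
  obtain ⟨S, hS, hKS, hSU, hSv, heq⟩ := Quasicrystal.exists_equidecomposable_between
    (Quasicrystal.dense_dualProj hΓ) (Quasicrystal.riemannMeasurable_parallelepiped v)
    hK hU hKU hKD hDU
  exact ⟨S, hS, hKS, hSU, hSv, v, hv, hvind, heq⟩
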